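/- Let $k$ be a field, let $A=k[\epsilon]/(\epsilon^2)$, and let $D^b(A)$ be the bounded derived category of the abelian category $A\text{-}\mathrm{mod}_{fg}$ of finitely generated $A$-modules. Let $X_1$ be the complex with the single non-zero term $A$ in degree $-1$, and let $X_\infty$ be the complex $\cdots\xrightarrow{\epsilon}A\xrightarrow{\epsilon}A\to 0$ with one copy of $A$ in each degree $\le -1$ and all differentials between these copies equal to multiplication by $\epsilon$; both are objects of $D^b(A)$. A t-structure on $D^b(A)$ is a full additive subcategory $\mathscr F$, closed under isomorphism, with $\mathscr F[1]\subset\mathscr F$, such that every object $E$ fits into a distinguished triangle $F\to E\to G\to F[1]$ with $F\in\mathscr F$ and $G\in\mathscr F^\perp$; its heart is $\mathscr F\cap\mathscr F^\perp[1]$. It is bounded if every object lies in $\mathscr F[i]\cap\mathscr F^\perp[j]$ for some $i,j\in\mathbb Z$ (in particular $\mathscr F\neq 0$ and $\mathscr F\ne D^b(A)$). The standard t-structure is $\mathscr F_{st}=\{X : H^i(X)=0 \text{ for all } i\ge 0\}$. Then: (1) a t-structure $\mathscr F$ on $D^b(A)$ is bounded if and only if $\mathscr F=\mathscr F_{st}[n]$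 for some $n\in\mathbb Z$; (2) the heart of the standard t-structure is $\mathrm{add}\{X_1,X_\infty\}$, the full subcategory of all direct summands of finite direct sums of copies of $X_1$ and $X_\infty$; (3) the functor $A\text{-}\mathrm{mod}_{fg}\to D^b(A)$, $M\mapsto M[1]$ (that is, $M$ placed in degree $-1$), is fully faithful and its essential image is the heart of the standard t-structure. -/

import Mathlib

open CategoryTheory Limits Triangulated DualNumber

universe w v u

namespace CategoryTheory

/-- `add P`: the direct summands (retracts) of finite direct sums of objects satisfying `P`. -/
def ObjectProperty.add {C : Type u} [Category.{v} C] [HasZeroMorphisms C] [HasFiniteBiproducts C]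
    (P : ObjectProperty C) : ObjectProperty C :=
  fun X ↦ ∃ (n : ℕ) (Y : Fin n → C), (∀ i, P (Y i)) ∧ Nonempty (Retract X (⨁ Y))

namespace Triangulated.TStructure

variable {C : Type u} [Category.{v} C] [Preadditive C] [HasZeroObject C] [HasShift C ℤ]
  [∀ (n : ℤ), (shiftFunctor C n).Additive] [Pretriangulated C]

/-- The shift of a t-structure by `n : ℤ`: since `t.le 0 = 𝓕` and `t.le (-n) = 𝓕[n]`, this is the
t-structure whose aisle `le 0` is `𝓕[n]`. -/
def shiftBy (t : TStructure C) (n : ℤ) : TStructure C where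
  le i := t.le (i - n)
  ge i := t.ge (i - n)
  le_shift i a i' h X hX := t.le_shift (i - n) a (i' - n) (by lia) X hX
  ge_shift i a i' h X hX := t.ge_shift (i - n) a (i' - n) (by lia) X hX
  zero' X Y f hX hY :=
    t.zero_of_isLE_of_isGE f (0 - n) (1 - n) (by lia) ⟨hX⟩ ⟨hY⟩
  le_zero_le := t.le_monotone (by lia)
  ge_one_le := t.ge_antitone (by lia)
  exists_triangle_zero_one A := t.exists_triangle A (0 - n) (1 - n) (by lia)

/-- A t-structure is bounded if every object lies in `le a ∩ ge b` for some integers `a`, `b`. -/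
def IsBounded (t : TStructure C) : Prop :=
  ∀ X : C, ∃ a b : ℤ, t.le a X ∧ t.ge b X

end Triangulated.TStructure

end CategoryTheory

namespace DualNumberDb

variable (k : Type u) [Field k]

/-- The abelian category of finitely generated modules over `A = k[ε]`. -/
abbrev ModFG : Type (u + 1) := FGModuleCat.{u} k[ε]

/-- The free module `A` of rank one. -/
noncomputable abbrev freeOne : ModFG k := FGModuleCat.of k[ε] k[ε]

/-- Multiplication by `ε` on `A`. -/
noncomputable def mulEps : freeOne k ⟶ freeOne k :=
  FGModuleCat.ofHom (LinearMap.mulLeft k[ε] (ε : k[ε]))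

lemma mulEps_comp_mulEps : mulEps k ≫ mulEps k = 0 := by
  apply FGModuleCat.hom_ext
  apply LinearMap.ext
  intro x
  change (ε : k[ε]) * ((ε : k[ε]) * (show k[ε] from x)) = 0
  rw [← mul_assoc, eps_mul_eps, zero_mul]

/-- The chain complex `⋯ ⟶ A ⟶ A ⟶ A ⟶ 0` with all differentials multiplication by `ε`,
the last copy of `A` being in homological degree `0`. -/
noncomputable def epsChainComplex : ChainComplex (ModFG k) ℕ :=
  ChainComplex.of (fun _ ↦ freeOne k) (fun _ ↦ mulEps k) (fun _ ↦ mulEps_comp_mulEps k)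

/-- The cochain complex `⋯ ⟶ A ⟶ A ⟶ A ⟶ 0` with all differentials multiplication by `ε`,
the last copy of `A` being in cohomological degree `-1`. (The embedding sends `n : ℕ`
to the degree `-1 - n`.) -/
noncomputable def complexXInfty : CochainComplex (ModFG k) ℤ :=
  (epsChainComplex k).extend (ComplexShape.embeddingUpIntLE (-1))

/-- The complex with the single nonzero term `A`, in cohomological degree `-1`. -/
noncomputable def complexXOne : CochainComplex (ModFG k) ℤ :=
  (CochainComplex.singleFunctor (ModFG k) (-1)).obj (freeOne k)

instance : (complexXInfty k).IsStrictlyLE (-1) := by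
  dsimp [complexXInfty]
  infer_instance

lemma exact_mulEps :
    (ShortComplex.mk (mulEps k) (mulEps k) (mulEps_comp_mulEps k)).Exact := by
  rw [← ShortComplex.exact_map_iff_of_faithful _ (forget₂ (ModFG k) (ModuleCat.{u} k[ε])),
    ShortComplex.moduleCat_exact_iff]
  intro x hx
  change k[ε] at x
  change (ε : k[ε]) * x = 0 at hx
  refine ⟨(TrivSqZeroExt.inl x.snd : k[ε]), ?_⟩
  change (ε : k[ε]) * (TrivSqZeroExt.inl x.snd : k[ε]) = x
  have h : x.fst = 0 := by simpa using congrArg TrivSqZeroExt.snd hx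
  ext <;> simp [h]

instance : (complexXInfty k).IsGE (-1) := by
  rw [CochainComplex.isGE_iff]
  intro i hi
  obtain ⟨n, hn⟩ : ∃ n : ℕ, i = -1 - ((n + 1 : ℕ) : ℤ) := ⟨(-2 - i).toNat, by lia⟩
  rw [complexXInfty, HomologicalComplex.extend_exactAt_iff _ _ (j := n + 1) (by simp [hn]),
    HomologicalComplex.exactAt_iff' _ (n + 2) (n + 1) n (by simp) (by simp)]
  have h (j : ℕ) : (epsChainComplex k).d (j + 1) j = mulEps k :=
    ChainComplex.of_d (fun _ ↦ freeOne k) (fun _ ↦ mulEps k) j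
  let e : (epsChainComplex k).sc' (n + 2) (n + 1) n ≅
      ShortComplex.mk (mulEps k) (mulEps k) (mulEps_comp_mulEps k) :=
    ShortComplex.isoMk (Iso.refl (freeOne k)) (Iso.refl (freeOne k)) (Iso.refl (freeOne k))
      ((Category.id_comp _).trans ((h (n + 1)).symm.trans (Category.comp_id _).symm))
      ((Category.id_comp _).trans ((h n).symm.trans (Category.comp_id _).symm))
  exact (ShortComplex.exact_iff_of_iso e).2 (exact_mulEps k)

variable [HasDerivedCategory.{w} (ModFG k)]

/-- The bounded derived category `Dᵇ(A)` of finitely generated `A`-modules. -/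
abbrev Db : Type (u + 1) := DerivedCategory.Bounded (ModFG k)

/-- The object `X_∞` of `Dᵇ(A)`. -/
noncomputable def XInfty : Db k :=
  ⟨DerivedCategory.Q.obj (complexXInfty k), ⟨⟨-1, inferInstance⟩, ⟨-1, inferInstance⟩⟩⟩

instance : (complexXOne k).IsStrictlyLE (-1) := by
  dsimp [complexXOne]; infer_instance

instance : (complexXOne k).IsStrictlyGE (-1) := by
  dsimp [complexXOne]; infer_instance

/-- The object `X_1` of `Dᵇ(A)`. -/
noncomputable def XOne : Db k :=
  ⟨DerivedCategory.Q.obj (complexXOne k), ⟨⟨-1, inferInstance⟩, ⟨-1, inferInstance⟩⟩⟩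

/-- The cohomology module `Hⁱ(X)` of an object of `Dᵇ(A)`. -/
noncomputable abbrev cohomology (i : ℤ) (X : Db k) : ModFG k :=
  (DerivedCategory.homologyFunctor (ModFG k) i).obj X.obj

/-- The standard t-structure on `Dᵇ(A)`, normalised so that its aisle `le 0` consists of the
objects with `Hⁱ = 0` for all `i ≥ 0` (see `standard_le_zero_iff`). -/
noncomputable def standard : TStructure (Db k) :=
  DerivedCategory.TStructure.t.onBounded.shiftBy 1

lemma standard_le_zero_iff (X : Db k) :
    (standard k).le 0 X ↔ ∀ i : ℤ, 0 ≤ i → IsZero (cohomology k i X) := by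
  have h : (standard k).le 0 X ↔ X.obj.IsLE (-1) := ⟨fun h ↦ ⟨h⟩, fun h ↦ h.le⟩
  rw [h, DerivedCategory.isLE_iff]
  exact ⟨fun h i hi ↦ h i (by lia), fun h i hi ↦ h i (by lia)⟩

lemma standard_ge_zero_iff (X : Db k) :
    (standard k).ge 0 X ↔ ∀ i : ℤ, i < -1 → IsZero (cohomology k i X) := by
  have h : (standard k).ge 0 X ↔ X.obj.IsGE (-1) := ⟨fun h ↦ ⟨h⟩, fun h ↦ h.ge⟩
  rw [h, DerivedCategory.isGE_iff]

/-- The functor sending a finitely generated `A`-module `M` to `M[1]`, that is `M` placed in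
cohomological degree `-1`, as an object of `Dᵇ(A)`. -/
noncomputable def moduleInDegNegOne : ModFG k ⥤ Db k :=
  DerivedCategory.TStructure.t.bounded.lift (DerivedCategory.singleFunctor (ModFG k) (-1))
    (fun _ ↦ ⟨⟨-1, inferInstance⟩, ⟨-1, inferInstance⟩⟩)

end DualNumberDb

/-!
The classification of bounded t-structures rests on a rigidity principle valid in any
pretriangulated category `C` (`TStructure.exists_eq_shiftBy_of_heart`). Let `s` be a bounded
t-structure on `C` such that there is a nonzero morphism `X ⟶ Y` for any nonzero objects `X` and
`Y` of its heart. Let `t` be any t-structure, `F ≠ 0` in its aisle and `G ≠ 0` in its coaisle. Let `m` be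
the largest `s`-degree in which `F` has cohomology and `l` the smallest one for `G`. Projecting `F`
onto its top cohomology, applying a nonzero morphism of the heart, and including the bottom
cohomology of `G` gives a nonzero morphism `F⟦m⟧ ⟶ G⟦l⟧` (`TStructure.exists_ne_zero_of_heart`).
If `l ≤ m`, this contradicts the orthogonality of the aisle and the coaisle of `t`; hence `m < l`.
So with `n` the largest value of `m`, the aisle of `t` lies in `s.le n` and its coaisle in
`s.ge (n + 1)`, and orthogonality turns both inclusions into equalities.

For `A = k[ε]` the hypothesis on the heart holds because every nonzero module surjects onto `k`, and
`k` embeds in every nonzero module (`exists_linearMap_ne_zero`).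

The heart of the standard t-structure consists of the objects `M[1]` with `M` a finitely generated
module. It contains `X_1 ≅ A[1]` by definition and `X_∞ ≅ k[1]` because the complex `X_∞` is a
resolution of `k = A / (ε)`. Every `M` is a summand of a finite sum of copies of `A` and `k`
(`exists_decomposition`): if `E` denotes multiplication by `ε` on `M` and `h` is a `k`-linear map
with `E h E = E`, then `id = (h E + E h) + π`, where `π` takes values in `ker E` and kills `im E`.
The map `h E + E h` factors through a free module, and `π` through a sum of copies of `k`.
-/

/-! ### Rigidity of t-structures whose heart has enough morphisms -/

namespace CategoryTheory.Triangulated.TStructure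

open Pretriangulated

variable {C : Type u} [Category.{v} C] [Preadditive C] [HasZeroObject C] [HasShift C ℤ]
  [∀ (n : ℤ), (shiftFunctor C n).Additive] [Pretriangulated C]

lemma eq_of_le_eq_le {t t' : TStructure C} (n : ℤ) (h : t.le n = t'.le n) : t = t' := by
  have hle : t.le = t'.le := by
    funext m
    rw [← t.shift_le (m - n) n m (by lia), ← t'.shift_le (m - n) n m (by lia), h]
  have hge : t.ge = t'.ge := by
    funext m
    ext X
    rw [ge_iff_isGE, ge_iff_isGE, t.isGE_iff_orthogonal (m - 1) m (by lia),
      t'.isGE_iff_orthogonal (m - 1) m (by lia)]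
    simp only [← le_iff_isLE, hle]
  cases t
  cases t'
  congr

lemma exists_isLE_and_not_isLE (s : TStructure C) (hs : s.IsBounded) {X : C} (hX : ¬ IsZero X) :
    ∃ m : ℤ, s.IsLE X m ∧ ¬ s.IsLE X (m - 1) := by
  obtain ⟨a, b, ha, hb⟩ := hs X
  have : s.IsLE X a := ⟨ha⟩
  have : s.IsGE X b := ⟨hb⟩
  obtain ⟨m, hm, hmin⟩ := Int.exists_least_of_bdd (P := fun m ↦ s.IsLE X m)
    ⟨b, fun m hm ↦ by
      by_contra! h
      exact hX (s.isZero X m b)⟩ ⟨a, inferInstance⟩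
  exact ⟨m, hm, fun h ↦ by have := hmin _ h; lia⟩

lemma exists_isGE_and_not_isGE (s : TStructure C) (hs : s.IsBounded) {X : C} (hX : ¬ IsZero X) :
    ∃ m : ℤ, s.IsGE X m ∧ ¬ s.IsGE X (m + 1) := by
  obtain ⟨a, b, ha, hb⟩ := hs X
  have : s.IsLE X a := ⟨ha⟩
  have : s.IsGE X b := ⟨hb⟩
  obtain ⟨m, hm, hmax⟩ := Int.exists_greatest_of_bdd (P := fun m ↦ s.IsGE X m)
    ⟨a, fun m hm ↦ by
      by_contra! h
      exact hX (s.isZero X a m)⟩ ⟨b, inferInstance⟩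
  exact ⟨m, hm, fun h ↦ by have := hmax _ h; lia⟩

/-- If `F` is concentrated in degrees `≤ 0`, `G` in degrees `≥ 0`, and both have nonzero cohomology
in degree `0`, then a nonzero morphism from the degree `0` cohomology of `F` to that of `G` induces
a nonzero morphism `F ⟶ G`. -/
lemma exists_ne_zero_of_heart (s : TStructure C)
    (hs : ∀ X Y : C, s.heart X → s.heart Y → ¬ IsZero X → ¬ IsZero Y → ∃ f : X ⟶ Y, f ≠ 0)
    {F G : C} (hF : s.IsLE F 0) (hF' : ¬ s.IsLE F (-1)) (hG : s.IsGE G 0) (hG' : ¬ s.IsGE G 1) :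
    ∃ f : F ⟶ G, f ≠ 0 := by
  -- `N` is the cohomology of `F` in degree `0`, and `N'` that of `G`.
  obtain ⟨A, N, hA, hN, a, p, d, hT⟩ := s.exists_triangle F (-1) 0 (by lia)
  obtain ⟨N', B, hN', hB, i, b, d', hT'⟩ := s.exists_triangle G 0 1 (by lia)
  have hA : s.IsLE A (-1) := ⟨hA⟩
  have hB : s.IsGE B 1 := ⟨hB⟩
  have hNge : s.IsGE N 0 := ⟨hN⟩
  have hN'le : s.IsLE N' 0 := ⟨hN'⟩
  have hA1 : s.IsLE (A⟦(1 : ℤ)⟧) (-2) := s.isLE_shift A (-1) 1 (-2)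
  have hB1 : s.IsGE (B⟦(-1 : ℤ)⟧) 2 := s.isGE_shift B 1 (-1) 2
  have hNle : s.IsLE N 0 :=
    s.isLE₂ _ (rot_of_distTriang _ hT) 0 hF (s.isLE_of_le (A⟦(1 : ℤ)⟧) (-2) 0)
  have hN'ge : s.IsGE N' 0 :=
    s.isGE₂ _ (inv_rot_of_distTriang _ hT') 0 (s.isGE_of_ge (B⟦(-1 : ℤ)⟧) 0 2) hG
  have hN0 : ¬ IsZero N := fun h ↦ hF' <| by
    have : IsIso a := (Triangle.isZero₃_iff_isIso₁ _ hT).1 h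
    exact s.isLE_of_iso (asIso a) (-1)
  have hN'0 : ¬ IsZero N' := fun h ↦ hG' <| by
    have : IsIso b := (Triangle.isZero₁_iff_isIso₂ _ hT').1 h
    exact s.isGE_of_iso (asIso b).symm 1
  obtain ⟨g, hg⟩ := hs N N' ⟨hNle.le, hNge.ge⟩ ⟨hN'le.le, hN'ge.ge⟩ hN0 hN'0
  refine ⟨p ≫ g ≫ i, fun h ↦ hg ?_⟩
  -- Precomposition with `p` is injective on maps to objects `≥ 0` since `A⟦1⟧` is `≤ -2`, and
  -- postcomposition with `i` is injective on maps from objects `≤ 0` since `B⟦-1⟧` is `≥ 2`.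
  have hgi : g ≫ i = 0 := by
    obtain ⟨φ : A⟦(1 : ℤ)⟧ ⟶ G, hφ : g ≫ i = d ≫ φ⟩ := Triangle.yoneda_exact₃ _ hT (g ≫ i) h
    rw [hφ, s.zero φ (-2) 0, comp_zero]
  obtain ⟨φ : N ⟶ B⟦(-1 : ℤ)⟧, hφ⟩ :=
    Triangle.coyoneda_exact₂ _ (inv_rot_of_distTriang _ hT') g hgi
  rw [hφ, show φ = 0 from s.zero φ 0 2]
  exact zero_comp

/-- A t-structure whose aisle and coaisle are both nonzero is a shift of any bounded t-structure `s`
with nonzero morphisms between any two nonzero objects of its heart. -/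
theorem exists_eq_shiftBy_of_heart (s : TStructure C) (hb : s.IsBounded)
    (hs : ∀ X Y : C, s.heart X → s.heart Y → ¬ IsZero X → ¬ IsZero Y → ∃ f : X ⟶ Y, f ≠ 0)
    (t : TStructure C) {F₀ G₀ : C} (hF₀ : t.IsLE F₀ 0) (hF₀' : ¬ IsZero F₀)
    (hG₀ : t.IsGE G₀ 1) (hG₀' : ¬ IsZero G₀) :
    ∃ n : ℤ, t = s.shiftBy n := by
  -- Nonzero objects of the aisle have their top `s`-degree below the bottom `s`-degree of nonzero
  -- objects of the coaisle.
  have key {F G : C} (hF : t.IsLE F 0) (hG : t.IsGE G 1) {m l : ℤ}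
      (hm : s.IsLE F m) (hm' : ¬ s.IsLE F (m - 1)) (hl : s.IsGE G l) (hl' : ¬ s.IsGE G (l + 1)) :
      m < l := by
    by_contra! hlm
    obtain ⟨f, hf⟩ := s.exists_ne_zero_of_heart hs (F := F⟦m⟧) (G := G⟦l⟧)
      (s.isLE_shift F m m 0) (by rwa [s.isLE_shift_iff F (m - 1) m (-1)])
      (s.isGE_shift G l l 0) (by rwa [s.isGE_shift_iff G (l + 1) l 1])
    have := t.isLE_shift F 0 m (-m)
    have := t.isGE_shift G 1 l (1 - l)
    exact hf (t.zero f (-m) (1 - l))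
  obtain ⟨l₀, hl₀, hl₀'⟩ := s.exists_isGE_and_not_isGE hb hG₀'
  obtain ⟨m₀, hm₀, hm₀'⟩ := s.exists_isLE_and_not_isLE hb hF₀'
  obtain ⟨n, ⟨F, hF, hn, hn'⟩, hmax⟩ := Int.exists_greatest_of_bdd
    (P := fun m ↦ ∃ F : C, t.IsLE F 0 ∧ s.IsLE F m ∧ ¬ s.IsLE F (m - 1))
    ⟨l₀, fun m ⟨F, hF, hm, hm'⟩ ↦ (key hF hG₀ hm hm' hl₀ hl₀').le⟩ ⟨m₀, F₀, hF₀, hm₀, hm₀'⟩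
  have hle (X : C) (hX : t.IsLE X 0) : s.IsLE X n := by
    by_cases h0 : IsZero X
    · exact s.isLE_of_isZero h0 n
    · obtain ⟨m, hm, hm'⟩ := s.exists_isLE_and_not_isLE hb h0
      exact s.isLE_of_le X m n (hmax m ⟨X, hX, hm, hm'⟩)
  have hge (X : C) (hX : t.IsGE X 1) : s.IsGE X (n + 1) := by
    by_cases h0 : IsZero X
    · exact s.isGE_of_isZero h0 _
    · obtain ⟨l, hl, hl'⟩ := s.exists_isGE_and_not_isGE hb h0
      exact s.isGE_of_ge X (n + 1) l (key hF hX hn hn' hl hl')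
  -- `s.shiftBy (-n)` has aisle `s.le (0 - -n) = s.le n`.
  refine ⟨-n, eq_of_le_eq_le 0 ?_⟩
  ext X
  change t.le 0 X ↔ s.le (0 - -n) X
  rw [show 0 - -n = n by lia, le_iff_isLE, le_iff_isLE]
  refine ⟨hle X, fun hX ↦ ?_⟩
  rw [t.isLE_iff_orthogonal 0 1 rfl]
  intro Y f hY
  have := hge Y hY
  exact s.zero f n (n + 1)

/-- The heart is closed under direct summands of finite direct sums. -/
lemma heart_of_sum_comp_eq_id (s : TStructure C) {ι : Type*} [Fintype ι] {X : C} (Y : ι → C)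
    (hY : ∀ j, s.heart (Y j)) (p : ∀ j, X ⟶ Y j) (i : ∀ j, Y j ⟶ X)
    (h : ∑ j, p j ≫ i j = 𝟙 X) : s.heart X := by
  rw [mem_heart_iff, s.isLE_iff_orthogonal 0 1 rfl, s.isGE_iff_orthogonal (-1) 0 rfl]
  simp only [mem_heart_iff] at hY
  constructor
  · intro Z f hZ
    rw [← Category.id_comp f, ← h, Preadditive.sum_comp]
    refine Finset.sum_eq_zero fun j _ ↦ ?_
    have := (hY j).1
    rw [Category.assoc, s.zero (i j ≫ f) 0 1, comp_zero]
  · intro Z f hZ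
    rw [← Category.comp_id f, ← h, Preadditive.comp_sum]
    refine Finset.sum_eq_zero fun j _ ↦ ?_
    have := (hY j).2
    rw [← Category.assoc, s.zero (f ≫ p j) (-1) 0, zero_comp]

end CategoryTheory.Triangulated.TStructure

namespace DualNumberDb

/-! ### Modules over the dual numbers -/

section Modules

variable {k : Type u} [Field k] {M N : Type*} [AddCommGroup M] [Module k[ε] M] [Module k M]
  [IsScalarTower k k[ε] M] [AddCommGroup N] [Module k[ε] N] [Module k N] [IsScalarTower k k[ε] N]

lemma dualNumber_smul_eq (a : k[ε]) (m : M) :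
    a • m = a.fst • m + a.snd • (ε : k[ε]) • m := by
  have h : a = a.fst • (1 : k[ε]) + a.snd • (ε : k[ε]) := by ext <;> simp
  conv_lhs => rw [h, add_smul, smul_assoc, smul_assoc, one_smul]

omit [Module k M] [IsScalarTower k k[ε] M] in
lemma eps_smul_eps_smul (m : M) : (ε : k[ε]) • (ε : k[ε]) • m = 0 := by
  rw [← mul_smul, eps_mul_eps, zero_smul]

/-- A `k`-linear map commuting with `ε`, as a `k[ε]`-linear map. -/
def linearMapOfEps (f : M →ₗ[k] N) (hf : ∀ m, f ((ε : k[ε]) • m) = (ε : k[ε]) • f m) :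
    M →ₗ[k[ε]] N where
  toFun := f
  map_add' := f.map_add
  map_smul' a m := by
    rw [dualNumber_smul_eq a m, map_add, map_smul, map_smul, hf, RingHom.id_apply,
      dualNumber_smul_eq a (f m)]

@[simp]
lemma linearMapOfEps_apply (f : M →ₗ[k] N) (hf) (m : M) : linearMapOfEps f hf m = f m := rfl

variable (k M) in
/-- Multiplication by `ε`, as a `k`-linear endomorphism. -/
def epsEnd : M →ₗ[k] M := (LinearMap.lsmul k[ε] M ε).restrictScalars k

@[simp]
lemma epsEnd_apply (m : M) : epsEnd k M m = (ε : k[ε]) • m := rfl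

variable (k M N) in
/-- There is a nonzero morphism between any two nonzero modules: a nonzero functional `ψ` on
`M / ε M` followed by the inclusion of a line `k u` killed by `ε`. -/
theorem exists_linearMap_ne_zero [Nontrivial M] [Nontrivial N] : ∃ f : M →ₗ[k[ε]] N, f ≠ 0 := by
  have hlt : LinearMap.range (epsEnd k M) < ⊤ := by
    rw [lt_top_iff_ne_top, ne_eq, LinearMap.range_eq_top]
    intro h
    obtain ⟨m, hm⟩ := exists_ne (0 : M)
    obtain ⟨m', rfl⟩ := h m
    obtain ⟨m'', rfl⟩ := h m'
    exact hm (eps_smul_eps_smul m'')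
  obtain ⟨ψ, hψ, hker⟩ := Submodule.exists_le_ker_of_lt_top _ hlt
  obtain ⟨u, hu, hεu⟩ : ∃ u : N, u ≠ 0 ∧ (ε : k[ε]) • u = 0 := by
    obtain ⟨n, hn⟩ := exists_ne (0 : N)
    by_cases h : (ε : k[ε]) • n = 0
    · exact ⟨n, hn, h⟩
    · exact ⟨_, h, eps_smul_eps_smul n⟩
  refine ⟨linearMapOfEps (ψ.smulRight u) fun m ↦ ?_, fun h ↦ hψ ?_⟩
  · have h0 : ψ ((ε : k[ε]) • m) = 0 := hker ⟨m, rfl⟩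
    rw [LinearMap.smulRight_apply, LinearMap.smulRight_apply, h0, zero_smul, smul_comm, hεu,
      smul_zero]
  · ext m
    have := LinearMap.congr_fun h m
    simpa [hu] using this

/-- Every endomorphism of a vector space has a generalized inverse. -/
lemma exists_pseudoinverse {V : Type*} [AddCommGroup V] [Module k V] (E : V →ₗ[k] V) :
    ∃ h : V →ₗ[k] V, ∀ v, E (h (E v)) = E v := by
  obtain ⟨s, hs⟩ := E.rangeRestrict.exists_rightInverse_of_surjective E.range_rangeRestrict
  obtain ⟨r, hr⟩ := (LinearMap.range E).subtype.exists_leftInverse_of_injective (by simp)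
  refine ⟨s ∘ₗ r, fun v ↦ ?_⟩
  have h1 : r (E v) = E.rangeRestrict v := LinearMap.congr_fun hr (E.rangeRestrict v)
  have h2 := congrArg Subtype.val (LinearMap.congr_fun hs (E.rangeRestrict v))
  rw [LinearMap.comp_apply, h1]
  exact h2

variable (k) in
/-- The residue field `k[ε] / (ε)`, as a `k[ε]`-module. -/
abbrev Residue : Type u := k[ε] ⧸ LinearMap.range (LinearMap.mulLeft k[ε] (ε : k[ε]))

lemma eps_smul_residue (x : Residue k) : (ε : k[ε]) • x = 0 := by
  obtain ⟨a, rfl⟩ := Submodule.Quotient.mk_surjective _ x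
  exact (Submodule.Quotient.mk_eq_zero _).2 ⟨a, rfl⟩

/-- The `k[ε]`-linear map `m ↦ c (ε m) + c m ε` with values in the free module, attached to a
`k`-linear functional `c` by coinduction. -/
def toFree (c : M →ₗ[k] k) : M →ₗ[k[ε]] k[ε] :=
  linearMapOfEps (Algebra.linearMap k k[ε] ∘ₗ c ∘ₗ epsEnd k M + TrivSqZeroExt.inrHom k k ∘ₗ c)
    fun m ↦ by ext <;> simp [eps_smul_eps_smul, TrivSqZeroExt.algebraMap_eq_inl]

@[simp]
lemma fst_toFree (c : M →ₗ[k] k) (m : M) : (toFree c m).fst = c ((ε : k[ε]) • m) := by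
  simp [toFree, TrivSqZeroExt.algebraMap_eq_inl]

@[simp]
lemma snd_toFree (c : M →ₗ[k] k) (m : M) : (toFree c m).snd = c m := by
  simp [toFree, TrivSqZeroExt.algebraMap_eq_inl]

instance : Module.Finite k k[ε] := inferInstanceAs (Module.Finite k (k × k))

/-- The `k[ε]`-linear map `M → k[ε] / (ε)` attached to a functional vanishing on `ε M`. -/
def toResidue (c : M →ₗ[k] k) (hc : ∀ m, c ((ε : k[ε]) • m) = 0) : M →ₗ[k[ε]] Residue k :=
  linearMapOfEps (((LinearMap.range (LinearMap.mulLeft k[ε] (ε : k[ε]))).mkQ.restrictScalars k) ∘ₗ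
    Algebra.linearMap k k[ε] ∘ₗ c) fun m ↦ by
      rw [eps_smul_residue, LinearMap.comp_apply, LinearMap.comp_apply, hc, map_zero, map_zero]

/-- The `k[ε]`-linear map `k[ε] / (ε) → M` sending `1` to an element `u` killed by `ε`. -/
def ofResidue (u : M) (hu : (ε : k[ε]) • u = 0) : Residue k →ₗ[k[ε]] M :=
  Submodule.liftQ _ (LinearMap.toSpanSingleton k[ε] M u) <| by
    rintro _ ⟨a, rfl⟩
    change ((ε : k[ε]) * a) • u = 0
    rw [mul_comm, mul_smul, hu, smul_zero]

lemma ofResidue_toResidue (c : M →ₗ[k] k) (hc : ∀ m, c ((ε : k[ε]) • m) = 0)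
    (u : N) (hu : (ε : k[ε]) • u = 0) (m : M) : ofResidue u hu (toResidue c hc m) = c m • u :=
  algebraMap_smul k[ε] (c m) u

variable (k M) in
/-- The identity of a finitely generated `k[ε]`-module is a finite sum of endomorphisms factoring
through `k[ε]` or `k[ε] / (ε)`. -/
theorem exists_decomposition [Module.Finite k[ε] M] :
    ∃ (a b : ℕ) (p : Fin a → M →ₗ[k[ε]] k[ε]) (i : Fin a → k[ε] →ₗ[k[ε]] M)
      (q : Fin b → M →ₗ[k[ε]] Residue k) (j : Fin b → Residue k →ₗ[k[ε]] M),
      ∀ m, ∑ l, i l (p l m) + ∑ l, j l (q l m) = m := by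
  have : Module.Finite k M := Module.Finite.trans k[ε] M
  obtain ⟨h, hh⟩ := exists_pseudoinverse (epsEnd k M)
  simp only [epsEnd_apply] at hh
  let e := Module.finBasis k M
  let K := LinearMap.ker (epsEnd k M)
  let b := Module.finBasis k K
  -- `π = id - (h E + E h)` takes values in `ker E` and kills `im E` because `E h E = E`.
  let π : M →ₗ[k] K := LinearMap.codRestrict K
      (LinearMap.id - h ∘ₗ epsEnd k M - epsEnd k M ∘ₗ h) fun m ↦ by
    simp [K, smul_sub, hh, eps_smul_eps_smul]
  have hπ (m : M) : (π m : M) = m - h ((ε : k[ε]) • m) - (ε : k[ε]) • h m := rfl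
  have hπε (m : M) : π ((ε : k[ε]) • m) = 0 := by
    ext
    simp [hπ, hh, eps_smul_eps_smul]
  refine ⟨_, _, fun l ↦ toFree (e.coord l ∘ₗ h), fun l ↦ LinearMap.toSpanSingleton k[ε] M (e l),
    fun l ↦ toResidue (b.coord l ∘ₗ π) fun m ↦ ?_, fun l ↦ ofResidue (b l : M) (b l).2,
    fun m ↦ ?_⟩
  · rw [LinearMap.comp_apply, hπε, map_zero]
  · have h1 (l) : LinearMap.toSpanSingleton k[ε] M (e l) (toFree (e.coord l ∘ₗ h) m) =
        e.repr (h ((ε : k[ε]) • m)) l • e l + (ε : k[ε]) • e.repr (h m) l • e l := by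
      rw [LinearMap.toSpanSingleton_apply, dualNumber_smul_eq, fst_toFree, snd_toFree, smul_comm ε]
      rfl
    have h2 : ∑ l, b.repr (π m) l • (b l : M) = π m := by
      have := congrArg K.subtype (b.sum_repr (π m))
      rwa [map_sum] at this
    have h3 (l) (hl) : ofResidue (b l : M) (b l).2 (toResidue (b.coord l ∘ₗ π) hl m) =
        b.repr (π m) l • (b l : M) := ofResidue_toResidue _ hl _ _ m
    simp only [h1, h3, Finset.sum_add_distrib, ← Finset.smul_sum, e.sum_repr, h2, hπ]
    abel

end Modules

/-! ### The category of finitely generated modules -/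

variable (k : Type u) [Field k]

lemma ModFG.exists_hom_ne_zero {M N : ModFG k} (hM : ¬ IsZero M) (hN : ¬ IsZero N) :
    ∃ f : M ⟶ N, f ≠ 0 := by
  let : Module k M := Module.compHom M (algebraMap k k[ε])
  let : Module k N := Module.compHom N (algebraMap k k[ε])
  have : IsScalarTower k k[ε] M := IsScalarTower.of_compHom k k[ε] M
  have : IsScalarTower k k[ε] N := IsScalarTower.of_compHom k k[ε] N
  have nontriv {P : ModFG k} (hP : ¬ IsZero P) : Nontrivial P := by
    by_contra h
    rw [not_nontrivial_iff_subsingleton] at h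
    refine hP ((IsZero.iff_id_eq_zero P).2 ?_)
    ext x
    exact Subsingleton.elim (α := P) _ _
  have := nontriv hM
  have := nontriv hN
  obtain ⟨f, hf⟩ := exists_linearMap_ne_zero k M N
  refine ⟨FGModuleCat.ofHom f, fun h ↦ hf ?_⟩
  ext m
  exact ConcreteCategory.congr_hom h m

/-- The residue field `k[ε] / (ε)` as an object of `ModFG k`. -/
noncomputable abbrev residueObj : ModFG k := FGModuleCat.of k[ε] (Residue k)

/-- Every object of `ModFG k` is a direct summand of a finite direct sum of copies of `k[ε]` and
`k[ε] / (ε)`. -/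
lemma ModFG.exists_sum_comp_eq_id (M : ModFG k) :
    ∃ (ι : Type) (_ : Fintype ι) (Z : ι → ModFG k),
      (∀ l, Z l = freeOne k ∨ Z l = residueObj k) ∧
      ∃ (p : ∀ l, M ⟶ Z l) (i : ∀ l, Z l ⟶ M), ∑ l, p l ≫ i l = 𝟙 M := by
  let : Module k M := Module.compHom M (algebraMap k k[ε])
  have : IsScalarTower k k[ε] M := IsScalarTower.of_compHom k k[ε] M
  obtain ⟨a, b, p, i, q, j, h⟩ := exists_decomposition k M
  refine ⟨Fin a ⊕ Fin b, inferInstance, Sum.elim (fun _ ↦ freeOne k) (fun _ ↦ residueObj k),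
    by simp, Sum.rec (fun l ↦ FGModuleCat.ofHom (p l)) (fun l ↦ FGModuleCat.ofHom (q l)),
    Sum.rec (fun l ↦ FGModuleCat.ofHom (i l)) (fun l ↦ FGModuleCat.ofHom (j l)), ?_⟩
  rw [Fintype.sum_sum_type]
  apply (forget₂ (ModFG k) (ModuleCat k[ε])).map_injective
  rw [Functor.map_add, Functor.map_sum, Functor.map_sum]
  ext m
  simp only [ModuleCat.hom_add, ModuleCat.hom_sum, LinearMap.add_apply, LinearMap.sum_apply]
  exact h m

/-! ### The cohomology of `X_∞` -/

/-- The quotient map `k[ε] ⟶ k[ε] / (ε)`. -/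
noncomputable def residueπ : freeOne k ⟶ residueObj k :=
  FGModuleCat.ofHom (LinearMap.range (LinearMap.mulLeft k[ε] (ε : k[ε]))).mkQ

lemma mulEps_comp_residueπ : mulEps k ≫ residueπ k = 0 := by
  apply FGModuleCat.hom_ext
  apply LinearMap.ext
  intro x
  exact (Submodule.Quotient.mk_eq_zero _).2 ⟨x, rfl⟩

/-- `k[ε] / (ε)` is the cokernel of multiplication by `ε`. -/
noncomputable def residueIsCokernel :
    IsColimit (CokernelCofork.ofπ (residueπ k) (mulEps_comp_residueπ k)) := by
  refine Cofork.IsColimit.mk _ (fun s ↦ FGModuleCat.ofHom (Submodule.liftQ _ s.π.hom.hom ?_)) ?_ ?_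
  · rintro _ ⟨x, rfl⟩
    exact ConcreteCategory.congr_hom (CokernelCofork.condition s) x
  · intro s
    rfl
  · intro s m hm
    ext x
    obtain ⟨a, rfl⟩ := Submodule.Quotient.mk_surjective _ x
    exact ConcreteCategory.congr_hom hm a

lemma epsChainComplex_d : (epsChainComplex k).d 1 0 = mulEps k := by
  exact ChainComplex.of_d (fun _ ↦ freeOne k) (fun _ ↦ mulEps k) 0

/-- The cohomology of the complex `X_∞` in degree `-1` is `k[ε] / (ε)`. -/
noncomputable def homologyXInftyIso : (complexXInfty k).homology (-1) ≅ residueObj k :=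
  (epsChainComplex k).extendHomologyIso (ComplexShape.embeddingUpIntLE (-1)) (j := 0) (by simp) ≪≫
    (epsChainComplex k).isoHomologyι₀ ≪≫
    IsColimit.coconePointUniqueUpToIso
      (isCokernelOfComp (𝟙 (freeOne k)) _
        ((epsChainComplex k).opcyclesIsCokernel 1 0 (by simp))
        ((congrArg (· ≫ (epsChainComplex k).pOpcycles 0) (epsChainComplex_d k).symm).trans
          ((epsChainComplex k).d_pOpcycles 1 0))
        ((Category.id_comp _).trans (epsChainComplex_d k).symm))
      (residueIsCokernel k)

/-! ### The standard t-structure and its heart -/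

variable [HasDerivedCategory.{w} (ModFG k)]

instance : (moduleInDegNegOne k).Full :=
  Functor.Full.of_comp_faithful_iso (G := DerivedCategory.TStructure.t.bounded.ι)
    (H := DerivedCategory.singleFunctor (ModFG k) (-1)) (Iso.refl _)

instance : (moduleInDegNegOne k).Faithful :=
  Functor.Faithful.of_comp_iso (G := DerivedCategory.TStructure.t.bounded.ι)
    (H := DerivedCategory.singleFunctor (ModFG k) (-1)) (Iso.refl _)

lemma isBounded_standard : (standard k).IsBounded := by
  rintro ⟨X, ⟨a, ha⟩, ⟨b, hb⟩⟩
  refine ⟨b + 1, a + 1, ?_, ?_⟩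
  · change DerivedCategory.TStructure.t.le (b + 1 - 1) X
    simpa using hb.le
  · change DerivedCategory.TStructure.t.ge (a + 1 - 1) X
    simpa using ha.ge

lemma standard_heart_iff (X : Db k) : (standard k).heart X ↔ X.obj.IsLE (-1) ∧ X.obj.IsGE (-1) :=
  ⟨fun h ↦ ⟨⟨h.1⟩, ⟨h.2⟩⟩, fun h ↦ ⟨h.1.le, h.2.ge⟩⟩

lemma moduleInDegNegOne_mem_heart (M : ModFG k) :
    (standard k).heart ((moduleInDegNegOne k).obj M) := by
  rw [standard_heart_iff]
  exact ⟨inferInstanceAs (((DerivedCategory.singleFunctor (ModFG k) (-1)).obj M).IsLE (-1)),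
    inferInstanceAs (((DerivedCategory.singleFunctor (ModFG k) (-1)).obj M).IsGE (-1))⟩

lemma essImage_moduleInDegNegOne :
    (moduleInDegNegOne k).essImage = (standard k).heart := by
  ext X
  constructor
  · rintro ⟨M, ⟨e⟩⟩
    exact (standard k).heart.prop_of_iso e (moduleInDegNegOne_mem_heart k M)
  · intro h
    rw [standard_heart_iff] at h
    obtain ⟨_, _⟩ := h
    obtain ⟨M, ⟨e⟩⟩ := X.obj.exists_iso_singleFunctor_obj_of_isGE_of_isLE (-1)
    exact ⟨M, ⟨DerivedCategory.TStructure.t.bounded.ι.preimageIso e.symm⟩⟩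

instance : (moduleInDegNegOne k).Additive where
  map_add {M N f g} := by
    apply DerivedCategory.TStructure.t.bounded.ι.map_injective
    exact (DerivedCategory.singleFunctor (ModFG k) (-1)).map_add

/-- `X_1` is the free module of rank one placed in degree `-1`. -/
noncomputable def XOneIso : XOne k ≅ (moduleInDegNegOne k).obj (freeOne k) :=
  Iso.refl _

lemma XInfty_mem_heart : (standard k).heart (XInfty k) := by
  rw [standard_heart_iff]
  exact ⟨inferInstanceAs ((DerivedCategory.Q.obj (complexXInfty k)).IsLE (-1)),
    inferInstanceAs ((DerivedCategory.Q.obj (complexXInfty k)).IsGE (-1))⟩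

/-- `X_∞` is the residue field placed in degree `-1`: it lies in the heart, hence is determined by
its cohomology in degree `-1`. -/
lemma nonempty_XInftyIso : Nonempty (XInfty k ≅ (moduleInDegNegOne k).obj (residueObj k)) := by
  have h := XInfty_mem_heart k
  rw [← essImage_moduleInDegNegOne] at h
  obtain ⟨M, ⟨e⟩⟩ := h
  let F := DerivedCategory.homologyFunctor (ModFG k) (-1)
  let e' : M ≅ residueObj k :=
    ((DerivedCategory.singleFunctorCompHomologyFunctorIso (ModFG k) (-1)).app M).symm ≪≫
      (DerivedCategory.TStructure.t.bounded.ι ⋙ F).mapIso e ≪≫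
      (DerivedCategory.homologyFunctorFactors (ModFG k) (-1)).app (complexXInfty k) ≪≫
      homologyXInftyIso k
  exact ⟨e.symm ≪≫ (moduleInDegNegOne k).mapIso e'⟩

lemma exists_hom_ne_zero_of_heart_standard (X Y : Db k) (hX : (standard k).heart X)
    (hY : (standard k).heart Y) (hX0 : ¬ IsZero X) (hY0 : ¬ IsZero Y) : ∃ f : X ⟶ Y, f ≠ 0 := by
  rw [← essImage_moduleInDegNegOne] at hX hY
  obtain ⟨M, ⟨e⟩⟩ := hX
  obtain ⟨N, ⟨e'⟩⟩ := hY
  obtain ⟨f, hf⟩ := ModFG.exists_hom_ne_zero k (M := M) (N := N)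
    (fun h ↦ hX0 (((moduleInDegNegOne k).map_isZero h).of_iso e.symm))
    (fun h ↦ hY0 (((moduleInDegNegOne k).map_isZero h).of_iso e'.symm))
  refine ⟨e.inv ≫ (moduleInDegNegOne k).map f ≫ e'.hom, fun h ↦ hf ?_⟩
  rwa [Preadditive.IsIso.comp_left_eq_zero, Preadditive.IsIso.comp_right_eq_zero,
    Functor.map_eq_zero_iff] at h

lemma exists_not_isZero : ∃ X : Db k, ¬ IsZero X := by
  refine ⟨(moduleInDegNegOne k).obj (freeOne k), fun h ↦ ?_⟩
  rw [IsZero.iff_id_eq_zero, ← CategoryTheory.Functor.map_id, Functor.map_eq_zero_iff] at h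
  exact one_ne_zero (α := k[ε]) (ConcreteCategory.congr_hom h (1 : k[ε]))

/-! ### Bounded t-structures, and the heart as an additive closure -/

theorem isBounded_iff (t : TStructure (Db k)) :
    t.IsBounded ↔ ∃ n : ℤ, t = (standard k).shiftBy n := by
  constructor
  · intro ht
    obtain ⟨X, hX⟩ := exists_not_isZero k
    obtain ⟨a, b, ha, hb⟩ := ht X
    -- `X⟦a⟧` and `X⟦b - 1⟧` are nonzero objects of the aisle and of the coaisle of `t`.
    have shift_ne (n : ℤ) : ¬ IsZero (X⟦n⟧) := fun h ↦ hX <| by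
      rwa [IsZero.iff_id_eq_zero, ← CategoryTheory.Functor.map_id, Functor.map_eq_zero_iff,
        ← IsZero.iff_id_eq_zero] at h
    exact TStructure.exists_eq_shiftBy_of_heart _ (isBounded_standard k)
      (exists_hom_ne_zero_of_heart_standard k) t
      ⟨t.le_shift a a 0 (by lia) X ha⟩ (shift_ne a)
      ⟨t.ge_shift b (b - 1) 1 (by lia) X hb⟩ (shift_ne (b - 1))
  · rintro ⟨n, rfl⟩ X
    obtain ⟨a, b, ha, hb⟩ := isBounded_standard k X
    refine ⟨a + n, b + n, ?_, ?_⟩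
    · change (standard k).le (a + n - n) X
      rwa [add_sub_cancel_right]
    · change (standard k).ge (b + n - n) X
      rwa [add_sub_cancel_right]

theorem heart_standard_eq_add :
    (standard k).heart = ObjectProperty.add (fun X ↦ X = XOne k ∨ X = XInfty k) := by
  ext X
  constructor
  · intro hX
    rw [← essImage_moduleInDegNegOne] at hX
    obtain ⟨M, ⟨e⟩⟩ := hX
    obtain ⟨ι, _, Z, hZ, p, i, h⟩ := ModFG.exists_sum_comp_eq_id k M
    have hY (l : ι) : ∃ Y : Db k, (Y = XOne k ∨ Y = XInfty k) ∧
        Nonempty ((moduleInDegNegOne k).obj (Z l) ≅ Y) := by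
      obtain h | h := hZ l
      · exact ⟨_, Or.inl rfl, ⟨(moduleInDegNegOne k).mapIso (eqToIso h) ≪≫ (XOneIso k).symm⟩⟩
      · exact ⟨_, Or.inr rfl, ⟨(moduleInDegNegOne k).mapIso (eqToIso h) ≪≫
          (nonempty_XInftyIso k).some.symm⟩⟩
    choose Y hY e' using hY
    let e' (l) := (e' l).some
    let σ := (Fintype.equivFin ι).symm
    refine ⟨_, Y ∘ σ, fun l ↦ hY _, ⟨{
      i := e.inv ≫ biproduct.lift fun l ↦ (moduleInDegNegOne k).map (p (σ l)) ≫ (e' (σ l)).hom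
      r := biproduct.desc (fun l ↦ (e' (σ l)).inv ≫ (moduleInDegNegOne k).map (i (σ l))) ≫ e.hom
      retract := ?_ }⟩⟩
    have h' := congrArg (moduleInDegNegOne k).map h
    rw [← Equiv.sum_comp σ] at h'
    simp only [Functor.map_sum, Functor.map_comp, CategoryTheory.Functor.map_id] at h'
    simp [biproduct.lift_desc_assoc, h']
  · rintro ⟨n, Y, hY, ⟨r⟩⟩
    refine (standard k).heart_of_sum_comp_eq_id Y (fun l ↦ ?_) (fun l ↦ r.i ≫ biproduct.π Y l)
      (fun l ↦ biproduct.ι Y l ≫ r.r) ?_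
    · obtain h | h := hY l
      · rw [h]
        exact (standard k).heart.prop_of_iso (XOneIso k).symm (moduleInDegNegOne_mem_heart k _)
      · rw [h]
        exact XInfty_mem_heart k
    · have h := biproduct.total (f := Y)
      have := congrArg (fun f ↦ r.i ≫ f ≫ r.r) h
      simpa only [Preadditive.comp_sum, Preadditive.sum_comp, Category.assoc, Category.id_comp,
        r.retract] using this

end DualNumberDb

theorem mainTheorem3 (k : Type u) [Field k] [HasDerivedCategory.{w} (FGModuleCat.{u} k[ε])] :
    -- the bounded t-structures on `Dᵇ(A)` are exactly the shifts of the standard one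
    (∀ t : TStructure (DualNumberDb.Db k),
      t.IsBounded ↔ ∃ n : ℤ, t = (DualNumberDb.standard k).shiftBy n) ∧
    -- the heart of the standard t-structure is `add {X_1, X_∞}`
    (DualNumberDb.standard k).heart =
      ObjectProperty.add (fun X ↦ X = DualNumberDb.XOne k ∨ X = DualNumberDb.XInfty k) ∧
    -- this heart is the category of finitely generated `A`-modules, embedded by `M ↦ M[1]`
    (DualNumberDb.moduleInDegNegOne k).Full ∧
    (DualNumberDb.moduleInDegNegOne k).Faithful ∧
    (DualNumberDb.moduleInDegNegOne k).essImage = (DualNumberDb.standard k).heart :=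
  ⟨DualNumberDb.isBounded_iff k, DualNumberDb.heart_standard_eq_add k, inferInstance,
    inferInstance, DualNumberDb.essImage_moduleInDegNegOne k⟩
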